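/- Let $\alpha\in(0,1)$ be irrational, let $1\le p<\infty$ and $\frac1p+\frac1q=1$, and let $T_\alpha f(t)=t\,f(\{t+\alpha\})$ be the Bishop operator on the complex space $L^p[0,1)$, where $\{\cdot\}$ denotes the fractional part. Let $T_\alpha^*$ be its adjoint with respect to the pairing $\langle f,g\rangle=\int_0^1 f(t)g(t)\,dt$, that is, the bounded operator $T_\alpha^*g(t)=\{t-\alpha\}\,g(\{t-\alpha\})$ on $L^q[0,1)$. Put $$\mathcal B_\alpha=\Big\{\tfrac1{20}<t<\tfrac{19}{20}\;:\;\langle t-n\alpha\rangle>\tfrac1{20n^2}\ \text{ for all } n\in\mathbb Z\setminus\{0\}\Big\},\qquad \langle x\rangle=\min(\{x\},1-\{x\}),$$ and let $1_{\mathcal B_\alpha}$ be its characteristic function. For a bounded linear operator $T$ on a complex Banach space $\mathcal X$ and $x\in\mathcal X$, the local spectrum $\sigma_T(x)$ is the complement in $\mathbb C$ of the set of all $\lambda$ for which there are an open neighbourhood $U$ of $\lambda$ and an analytic function $f:U\to\mathcal X$ with $(T-zI)f(z)=x$ for every $z\in U$. Then the local spectrum $\sigma_{T_\alpha}(1_{\mathcal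 B_\alpha})$ is symmetric with respect to the real axis and contains the point $e^{-1}$; likewise, the local spectrum $\sigma_{T_\alpha^*}(1_{\mathcal B_\alpha})$ is symmetric with respect to the real axis and contains the point $e^{-1}$. -/

import Mathlib

open MeasureTheory Set
open scoped ENNReal

namespace Bishop

noncomputable section

/-! ### Local spectra -/

section LocalSpectrum

variable {X : Type*} [NormedAddCommGroup X] [NormedSpace ℂ X]

/-- The local resolvent set `ρ_T(x)`: all `w` with an open neighbourhood `U` carrying an analytic
`X`-valued function `f` such that `(T - z I) f(z) = x` for every `z ∈ U`. -/
def localResolventSet (T : X →L[ℂ] X) (x : X) : Set ℂ :=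
  {w | ∃ U : Set ℂ, IsOpen U ∧ w ∈ U ∧ ∃ f : ℂ → X, AnalyticOnNhd ℂ f U ∧
    ∀ z ∈ U, T (f z) - z • f z = x}

/-- The local spectrum `σ_T(x)`, the complement of the local resolvent set. -/
def localSpectrum (T : X →L[ℂ] X) (x : X) : Set ℂ :=
  (localResolventSet T x)ᶜ

end LocalSpectrum

/-! ### The space `L^p[0,1)` and the rotation by `α` -/

/-- Lebesgue measure on `[0,1)`. -/
abbrev unitMeasure : Measure ℝ := volume.restrict (Ico 0 1)

/-- The complex space `L^p[0,1)`. -/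
abbrev LpUnit (p : ℝ≥0∞) := Lp ℂ p unitMeasure

/-- The rotation `t ↦ {t + α}`. -/
def rot (α t : ℝ) : ℝ := Int.fract (t + α)

theorem measurable_rot (α : ℝ) : Measurable (rot α) :=
  measurable_fract.comp (measurable_id.add_const α)

theorem ae_mem_Ico : ∀ᵐ t ∂unitMeasure, t ∈ Ico (0 : ℝ) 1 :=
  ae_restrict_mem measurableSet_Ico

theorem measurePreserving_rot (α : ℝ) : MeasurePreserving (rot α) unitMeasure unitMeasure := by
  have h1 : MeasurePreserving (fun t : ℝ => (t : AddCircle (1 : ℝ))) unitMeasure volume := by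
    have h := AddCircle.measurePreserving_mk (1 : ℝ) 0
    rw [zero_add, ← restrict_Ico_eq_restrict_Ioc] at h
    exact h
  have h2 : MeasurePreserving (fun x : AddCircle (1 : ℝ) => x + (α : AddCircle (1 : ℝ)))
      volume volume := measurePreserving_add_right volume _
  let c : AddCircle (1 : ℝ) → ℝ := fun x => (AddCircle.equivIco 1 0 x : ℝ)
  have hc : ∀ t : ℝ, c (t : AddCircle (1 : ℝ)) = Int.fract t := fun t => by
    have h := AddCircle.coe_equivIco_mk_apply (1 : ℝ) t
    rw [div_one, mul_one] at h
    exact h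
  have hcm : Measurable c :=
    measurable_subtype_coe.comp (AddCircle.measurableEquivIco 1 0).measurable
  have h3 : MeasurePreserving c volume unitMeasure := by
    refine ⟨hcm, ?_⟩
    rw [← h1.map_eq, Measure.map_map hcm h1.measurable]
    have h : (c ∘ fun t : ℝ => (t : AddCircle (1 : ℝ))) =ᵐ[unitMeasure] id := by
      filter_upwards [ae_mem_Ico] with t ht
      rw [Function.comp_apply, hc, id, Int.fract_eq_self.2 ht]
    rw [Measure.map_congr h, Measure.map_id]
  have h4 := h3.comp (h2.comp h1)
  have h5 : rot α = c ∘ ((fun x : AddCircle (1 : ℝ) => x + (α : AddCircle (1 : ℝ))) ∘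
      fun t : ℝ => (t : AddCircle (1 : ℝ))) := by
    funext t
    exact (hc (t + α)).symm
  rw [h5]
  exact h4

/-! ### Bishop operators -/

section Weighted

variable {p : ℝ≥0∞} {w : ℝ → ℝ}

theorem norm_weighted_le (α : ℝ) (hb : ∀ t ∈ Ico (0 : ℝ) 1, |w t| ≤ 1) (f : LpUnit p) :
    ∀ᵐ t ∂unitMeasure, ‖(w t : ℂ) * f (rot α t)‖ ≤ ‖(f ∘ rot α) t‖ := by
  filter_upwards [ae_mem_Ico] with t ht
  rw [norm_mul, Complex.norm_real, Real.norm_eq_abs, Function.comp_apply]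
  exact mul_le_of_le_one_left (norm_nonneg _) (hb t ht)

theorem memLp_weighted (α : ℝ) (hw : Measurable w) (hb : ∀ t ∈ Ico (0 : ℝ) 1, |w t| ≤ 1)
    (f : LpUnit p) : MemLp (fun t => (w t : ℂ) * f (rot α t)) p unitMeasure := by
  have h := (Lp.memLp f).comp_measurePreserving (measurePreserving_rot α)
  exact h.mono ((Complex.measurable_ofReal.comp hw).aestronglyMeasurable.mul h.1)
    (norm_weighted_le α hb f)

/-- The bounded operator `f ↦ w(t) f({t + α})` on `L^p[0,1)`, for a measurable real weight `w`
with `|w| ≤ 1` on `[0,1)`. -/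
def weightedRot (p : ℝ≥0∞) [Fact (1 ≤ p)] (α : ℝ) (w : ℝ → ℝ) (hw : Measurable w)
    (hb : ∀ t ∈ Ico (0 : ℝ) 1, |w t| ≤ 1) : LpUnit p →L[ℂ] LpUnit p :=
  LinearMap.mkContinuous
    { toFun := fun f => (memLp_weighted α hw hb f).toLp _
      map_add' := fun f g => by
        rw [← MemLp.toLp_add]
        refine MemLp.toLp_congr _ _ ?_
        filter_upwards [(measurePreserving_rot α).quasiMeasurePreserving.ae
          (Lp.coeFn_add f g)] with t ht
        rw [Pi.add_apply, ht, Pi.add_apply, mul_add]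
      map_smul' := fun c f => by
        rw [RingHom.id_apply, ← MemLp.toLp_const_smul]
        refine MemLp.toLp_congr _ _ ?_
        filter_upwards [(measurePreserving_rot α).quasiMeasurePreserving.ae
          (Lp.coeFn_smul c f)] with t ht
        rw [Pi.smul_apply, ht, Pi.smul_apply, smul_eq_mul, smul_eq_mul, mul_left_comm] }
    1 fun f => by
      rw [one_mul]
      change ‖(memLp_weighted α hw hb f).toLp _‖ ≤ ‖f‖
      rw [Lp.norm_toLp, Lp.norm_def]
      refine ENNReal.toReal_mono (Lp.eLpNorm_ne_top f) ?_
      refine (eLpNorm_mono_ae (norm_weighted_le α hb f)).trans_eq ?_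
      exact eLpNorm_comp_measurePreserving (Lp.aestronglyMeasurable f) (measurePreserving_rot α)

theorem weightedRot_coeFn [Fact (1 ≤ p)] (α : ℝ) (hw : Measurable w)
    (hb : ∀ t ∈ Ico (0 : ℝ) 1, |w t| ≤ 1) (f : LpUnit p) :
    weightedRot p α w hw hb f =ᵐ[unitMeasure] fun t => (w t : ℂ) * f (rot α t) :=
  MemLp.coeFn_toLp (memLp_weighted α hw hb f)

end Weighted

theorem abs_fract_le (x : ℝ) : |Int.fract x| ≤ 1 := by
  rw [abs_of_nonneg (Int.fract_nonneg x)]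
  exact (Int.fract_lt_one x).le

/-- The Bishop operator `T_α f(t) = t f({t + α})` on `L^p[0,1)`. -/
def bishop (p : ℝ≥0∞) [Fact (1 ≤ p)] (α : ℝ) : LpUnit p →L[ℂ] LpUnit p :=
  weightedRot p α (fun t => t) measurable_id fun t ht => by
    rw [abs_of_nonneg ht.1]
    exact ht.2.le

/-- The adjoint `T_α^*` on `L^q[0,1)`, namely `g ↦ {t - α} g({t - α})`; it is the adjoint of the
Bishop operator on `L^p[0,1)`, `1/p + 1/q = 1`, by `integral_bishop_mul` below. -/
def bishopAdjoint (q : ℝ≥0∞) [Fact (1 ≤ q)] (α : ℝ) : LpUnit q →L[ℂ] LpUnit q :=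
  weightedRot q (-α) (rot (-α)) (measurable_rot (-α)) fun _ _ => abs_fract_le _

theorem bishop_coeFn {p : ℝ≥0∞} [Fact (1 ≤ p)] (α : ℝ) (f : LpUnit p) :
    bishop p α f =ᵐ[unitMeasure] fun t => (t : ℂ) * f (Int.fract (t + α)) :=
  weightedRot_coeFn α _ _ f

theorem bishopAdjoint_coeFn {q : ℝ≥0∞} [Fact (1 ≤ q)] (α : ℝ) (g : LpUnit q) :
    bishopAdjoint q α g =ᵐ[unitMeasure]
      fun t => ((Int.fract (t - α) : ℝ) : ℂ) * g (Int.fract (t - α)) :=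
  weightedRot_coeFn (-α) _ _ g

/-- The duality `⟨T_α f, g⟩ = ⟨f, T_α^* g⟩` for the pairing `⟨f, g⟩ = ∫ f g` of `L^p[0,1)` and
`L^q[0,1)`. -/
theorem integral_bishop_mul {p q : ℝ≥0∞} [Fact (1 ≤ p)] [Fact (1 ≤ q)] [p.HolderConjugate q]
    (α : ℝ) (f : LpUnit p) (g : LpUnit q) :
    Integrable (fun t => bishop p α f t * g t) unitMeasure ∧
    Integrable (fun t => f t * bishopAdjoint q α g t) unitMeasure ∧
    ∫ t, bishop p α f t * g t ∂unitMeasure = ∫ t, f t * bishopAdjoint q α g t ∂unitMeasure := by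
  have hi : Integrable (fun t => bishop p α f t * g t) unitMeasure :=
    (Lp.memLp (bishop p α f)).integrable_mul (Lp.memLp g)
  refine ⟨hi, (Lp.memLp f).integrable_mul (Lp.memLp (bishopAdjoint q α g)), ?_⟩
  have hm := measurePreserving_rot (-α)
  have h1 : ∫ t, bishop p α f t * g t ∂unitMeasure =
      ∫ t, bishop p α f (rot (-α) t) * g (rot (-α) t) ∂unitMeasure := by
    have h := integral_map (μ := unitMeasure) (φ := rot (-α)) hm.measurable.aemeasurable
      (f := fun t => bishop p α f t * g t) (by rw [hm.map_eq]; exact hi.1)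
    rw [hm.map_eq] at h
    exact h
  rw [h1]
  refine integral_congr_ae ?_
  filter_upwards [hm.quasiMeasurePreserving.ae (bishop_coeFn α f), bishopAdjoint_coeFn α g,
    ae_mem_Ico] with t h2 h3 ht
  have h4 : Int.fract (rot (-α) t + α) = t := by
    have h5 : rot (-α) t + α = t - (⌊t + -α⌋ : ℤ) := by
      rw [rot, Int.fract]
      ring
    rw [h5, Int.fract_sub_intCast, Int.fract_eq_self.2 ht]
  have h6 : rot (-α) t = Int.fract (t - α) := by rw [rot, sub_eq_add_neg]
  rw [h2, h3, h4, h6]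
  ring

/-! ### The set `B_α` and its characteristic function -/

/-- The distance `⟨x⟩ = min({x}, 1 - {x})` from `x` to the closest integer. -/
def distInt (x : ℝ) : ℝ := min (Int.fract x) (1 - Int.fract x)

/-- The set `B_α` of all `1/20 < t < 19/20` with `⟨t - nα⟩ > 1/(20 n²)` for all integers `n ≠ 0`. -/
def setB (α : ℝ) : Set ℝ :=
  {t | 1 / 20 < t ∧ t < 19 / 20 ∧
    ∀ n : ℤ, n ≠ 0 → 1 / (20 * (n : ℝ) ^ 2) < distInt (t - n * α)}

theorem measurable_distInt : Measurable distInt :=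
  measurable_fract.min (measurable_const.sub measurable_fract)

theorem measurableSet_setB (α : ℝ) : MeasurableSet (setB α) := by
  have h : setB α = Ioo (1 / 20) (19 / 20) ∩
      ⋂ n : ℤ, ⋂ _ : n ≠ 0, {t : ℝ | 1 / (20 * (n : ℝ) ^ 2) < distInt (t - n * α)} := by
    ext t
    simp only [setB, mem_ofPred_eq, mem_inter_iff, mem_Ioo, mem_iInter, and_assoc]
  rw [h]
  refine measurableSet_Ioo.inter (MeasurableSet.iInter fun n => MeasurableSet.iInter fun _ => ?_)
  exact measurableSet_lt measurable_const
    (measurable_distInt.comp (measurable_id.sub_const ((n : ℝ) * α)))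

/-- The characteristic function of `B_α` as an element of `L^p[0,1)`. -/
def indB (p : ℝ≥0∞) (α : ℝ) : LpUnit p :=
  indicatorConstLp p (measurableSet_setB α) (measure_ne_top unitMeasure (setB α)) (1 : ℂ)

end

end Bishop

section

open Filter Topology

/-! ### Ergodicity of the rotation and the mean ergodic theorem -/

namespace Bishop

/-! Symmetry holds because both operators have real weights: complex conjugation commutes with them
and fixes the indicator, so a local resolvent function `f` on `U` yields `v ↦ conj (f (conj v))` on
the conjugate of `U`.

That `e⁻¹` belongs to the local spectrum is a positivity argument in the spirit of Pringsheim's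
theorem. Let `T` be either operator, with weight `w`, and `x` the indicator. Then `T^n b` is
`exp(S_n log w)` times `b` composed with the `n`-th iterate of the rotation, where `S_n` denotes the
Birkhoff sum. Since `log w` is square integrable with mean `-1`, the mean ergodic theorem gives `S_n
log w = n(-1 + o(1))` in measure, so `e⁻¹` is a critical radius.

For real `z > e⁻¹`, a solution of `(z - T) b = y` with `Re y ≥ 0` satisfies `Re b ≥ Re (z⁻ⁿ T^n b)`,
and the right side tends to `0` in measure; hence `Re b ≥ 0` (`ReNonneg.of_resolvent`). For `0 < z <
e⁻¹` and `y = x`, a solution with `Re b ≥ 0` would satisfy `T^n x ≤ z^(n+1) Re b` for all `n`, which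
is impossible as `z⁻ⁿ T^n x` is exponentially large on sets of measure close to that of the support
of `x` (`not_reNonneg_of_resolvent_indicator`).

Now let `f` be a local resolvent function near `e⁻¹`. Differentiating the equation gives `(T - z)
f^(m+1) = (m+1) f^(m)`, so by induction `(-1)^(m+1) f^(m)` has nonnegative real part at a point `z₀
> e⁻¹`. The Taylor series of `-f` at `z₀`, evaluated at some `z₁ < e⁻¹`, then has only terms with
nonnegative real part, which makes `-f z₁` a forbidden solution. Only positive measure of `setB α`
is needed; it comes from a union bound. -/

instance : IsProbabilityMeasure unitMeasure :=
  ⟨by simp [unitMeasure]⟩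

/-- The rotation by an irrational angle is ergodic. -/
theorem ergodic_rot {β : ℝ} (hβ : Irrational β) : Ergodic (rot β) unitMeasure := by
  have h1 : MeasurePreserving (fun t : ℝ => (t : AddCircle (1 : ℝ))) unitMeasure volume := by
    have h := AddCircle.measurePreserving_mk (1 : ℝ) 0
    rw [zero_add, ← restrict_Ico_eq_restrict_Ioc] at h
    exact h
  -- Taking representatives in `[0,1)` semiconjugates the rotation of the circle to `rot β`, so
  -- ergodicity is inherited from the circle.
  let c : AddCircle (1 : ℝ) → ℝ := fun x => (AddCircle.equivIco 1 0 x : ℝ)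
  have hc : ∀ t : ℝ, c (t : AddCircle (1 : ℝ)) = Int.fract t := fun t => by
    have h := AddCircle.coe_equivIco_mk_apply (1 : ℝ) t
    rw [div_one, mul_one] at h
    exact h
  have hcm : Measurable c :=
    measurable_subtype_coe.comp (AddCircle.measurableEquivIco 1 0).measurable
  have h3 : MeasurePreserving c volume unitMeasure := by
    refine ⟨hcm, ?_⟩
    rw [← h1.map_eq, Measure.map_map hcm h1.measurable]
    have h : (c ∘ fun t : ℝ => (t : AddCircle (1 : ℝ))) =ᵐ[unitMeasure] id := by
      filter_upwards [ae_mem_Ico] with t ht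
      rw [Function.comp_apply, hc, id, Int.fract_eq_self.2 ht]
    rw [Measure.map_congr h, Measure.map_id]
  have herg : Ergodic (· + (β : AddCircle (1 : ℝ))) := by
    rw [AddCircle.ergodic_add_right, addOrderOf_eq_zero_iff']
    intro n hn h
    rw [← AddCircle.coe_nsmul, AddCircle.coe_eq_zero_iff] at h
    obtain ⟨m, hm⟩ := h
    refine (hβ.natCast_mul hn.ne').ne_int m ?_
    simpa using hm.symm
  refine h3.ergodic_of_ergodic_semiconj herg (measurable_rot β) fun x => ?_
  induction x using QuotientAddGroup.induction_on with
  | H t =>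
    change c ((t : AddCircle (1 : ℝ)) + (β : AddCircle (1 : ℝ))) = rot β (c t)
    have h : Int.fract t + β = t + β - (⌊t⌋ : ℤ) := by
      rw [Int.fract]
      ring
    rw [← AddCircle.coe_add, hc, hc, rot, h, Int.fract_sub_intCast]

end Bishop

section MeanErgodic

variable {Ω : Type*} [MeasurableSpace Ω] {μ : Measure Ω}

/-- Von Neumann's theorem concerns averages of a Koopman isometry on classes in `L²`; this
translates them into pointwise orbit averages. -/
theorem birkhoffAverage_compMeasurePreserving_coeFn {f : Ω → Ω} (hf : MeasurePreserving f μ μ)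
    {g : Ω → ℝ} (hg : MemLp g 2 μ) (n : ℕ) :
    ((birkhoffAverage ℝ (Lp.compMeasurePreservingₗᵢ ℝ (E := ℝ) (p := 2) f hf) _root_.id n
      (hg.toLp g) : Lp ℝ 2 μ) : Ω → ℝ) =ᵐ[μ] birkhoffAverage ℝ f g n := by
  have hit : ∀ k : ℕ, (((Lp.compMeasurePreservingₗᵢ ℝ (E := ℝ) (p := 2) f hf)^[k]
      (hg.toLp g) : Lp ℝ 2 μ) : Ω → ℝ) =ᵐ[μ] g ∘ f^[k] := fun k => by
    induction k with
    | zero => simpa using hg.coeFn_toLp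
    | succ k ih =>
      rw [Function.iterate_succ_apply', Function.iterate_succ, ← Function.comp_assoc]
      exact (Lp.coeFn_compMeasurePreserving _ hf).trans
        (hf.quasiMeasurePreserving.ae_eq_comp ih)
  have hsum : ((birkhoffSum (Lp.compMeasurePreservingₗᵢ ℝ (E := ℝ) (p := 2) f hf) _root_.id n
      (hg.toLp g) : Lp ℝ 2 μ) : Ω → ℝ) =ᵐ[μ] birkhoffSum f g n := by
    induction n with
    | zero => simpa using Lp.coeFn_zero ℝ 2 μ
    | succ n ih =>
      rw [birkhoffSum_succ]
      filter_upwards [Lp.coeFn_add (birkhoffSum (Lp.compMeasurePreservingₗᵢ ℝ (E := ℝ) (p := 2) f hf)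
        _root_.id n (hg.toLp g)) ((Lp.compMeasurePreservingₗᵢ ℝ (E := ℝ) (p := 2) f hf)^[n]
        (hg.toLp g)), ih, hit n] with x h1 h2 h3
      rw [birkhoffSum_succ]
      simp only [id] at h1 ⊢
      rw [h1, Pi.add_apply, h2, h3, Function.comp_apply]
  rw [birkhoffAverage]
  filter_upwards [Lp.coeFn_smul ((n : ℝ)⁻¹) (birkhoffSum (Lp.compMeasurePreservingₗᵢ ℝ (E := ℝ)
    (p := 2) f hf) _root_.id n (hg.toLp g)), hsum] with x h1 h2
  rw [h1, Pi.smul_apply, h2, birkhoffAverage]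

/-- The mean ergodic theorem: the Birkhoff averages of a square integrable function under an
ergodic map converge in measure to its mean. -/
theorem tendstoInMeasure_birkhoffAverage [IsProbabilityMeasure μ] {f : Ω → Ω} (hf : Ergodic f μ)
    {g : Ω → ℝ} (hg : MemLp g 2 μ) :
    TendstoInMeasure μ (fun n => birkhoffAverage ℝ f g n) atTop fun _ => ∫ x, g x ∂μ := by
  set K := Lp.compMeasurePreservingₗᵢ ℝ (E := ℝ) (p := 2) f hf.toMeasurePreserving with hK
  set G := hg.toLp g
  set S := K.toContinuousLinearMap.eqLocus (1 : Lp ℝ 2 μ →L[ℝ] Lp ℝ 2 μ) with hS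
  have hlim := K.toContinuousLinearMap.tendsto_birkhoffAverage_orthogonalProjection
    K.norm_toContinuousLinearMap_le G
  have hconst : ((S.orthogonalProjectionOnto G).1 : Ω → ℝ) =ᵐ[μ]
      fun _ => ∫ x, g x ∂μ := by
    set P : Lp ℝ 2 μ := (S.orthogonalProjectionOnto G).1 with hP
    have hfix : K P = P := (S.orthogonalProjectionOnto G).2
    -- By ergodicity the fixed vectors are constants.
    obtain ⟨c, hc⟩ : ∃ c, (P : Ω → ℝ) =ᵐ[μ] Function.const Ω c := by
      refine hf.ae_eq_const_of_ae_eq_comp_ae (Lp.aestronglyMeasurable P) ?_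
      have h := Lp.coeFn_compMeasurePreserving P hf.toMeasurePreserving
      change (K P : Ω → ℝ) =ᵐ[μ] _ at h
      rw [hfix] at h
      exact h.symm
    -- The function `1` is fixed, hence orthogonal to `G - P`; this identifies the constant as the
    -- mean of `g`.
    set one : Lp ℝ 2 μ := (memLp_const (1 : ℝ)).toLp (fun _ : Ω => (1 : ℝ)) with hone
    have hone1 : (one : Ω → ℝ) =ᵐ[μ] fun _ => 1 := MemLp.coeFn_toLp _
    have hmem : one ∈ S := by
      change K one = one
      refine Lp.ext ((Lp.coeFn_compMeasurePreserving one hf.toMeasurePreserving).trans ?_)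
      exact (hf.quasiMeasurePreserving.ae_eq_comp hone1).trans hone1.symm
    have hin : inner ℝ one (G - P) = 0 :=
      (Submodule.mem_orthogonal S _).1 (S.sub_starProjection_mem_orthogonal G) one hmem
    rw [inner_sub_right, L2.inner_def, L2.inner_def] at hin
    have e1 : ∫ x, inner ℝ (one x) (G x) ∂μ = ∫ x, g x ∂μ := by
      refine integral_congr_ae ?_
      filter_upwards [hone1, hg.coeFn_toLp] with x h1 h2
      rw [h1, h2]; simp
    have e2 : ∫ x, inner ℝ (one x) (P x) ∂μ = c := by
      rw [integral_congr_ae (g := fun _ => c)]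
      · simp
      · filter_upwards [hone1, hc] with x h1 h2
        rw [h1, h2]; simp
    rw [e1, e2, sub_eq_zero] at hin
    rw [hin]
    exact hc
  refine (tendstoInMeasure_of_tendsto_Lp hlim).congr (fun n => ?_) hconst
  exact birkhoffAverage_compMeasurePreserving_coeFn hf.toMeasurePreserving hg n

end MeanErgodic

/-! ### Positivity and the resolvent equation on the positive real axis -/

namespace Bishop

variable {p : ℝ≥0∞}

/-- The cone of `L^p` functions with nonnegative real part. -/
def ReNonneg (f : LpUnit p) : Prop := ∀ᵐ t ∂unitMeasure, 0 ≤ (f t).re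

theorem ReNonneg.add {f g : LpUnit p} (hf : ReNonneg f) (hg : ReNonneg g) : ReNonneg (f + g) := by
  filter_upwards [Lp.coeFn_add f g, hf, hg] with t h1 h2 h3
  rw [h1, Pi.add_apply, Complex.add_re]
  exact add_nonneg h2 h3

theorem ReNonneg.smul {f : LpUnit p} (hf : ReNonneg f) {c : ℝ} (hc : 0 ≤ c) :
    ReNonneg ((c : ℂ) • f) := by
  filter_upwards [Lp.coeFn_smul (c : ℂ) f, hf] with t h1 h2
  rw [h1, Pi.smul_apply, smul_eq_mul, Complex.re_ofReal_mul]
  exact mul_nonneg hc h2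

theorem reNonneg_zero : ReNonneg (0 : LpUnit p) := by
  filter_upwards [Lp.coeFn_zero ℂ p unitMeasure] with t ht
  rw [ht]
  simp

variable [Fact (1 ≤ p)] {w : ℝ → ℝ} {β : ℝ} {hw : Measurable w}
  {hb : ∀ t ∈ Ico (0 : ℝ) 1, |w t| ≤ 1}

/-- Writing the product of weights along an orbit as an exponential hands its growth to the ergodic
theorem. Positivity of `w` is essential here, as `Real.log 0 = 0`. -/
theorem weightedRot_pow_coeFn (hpos : ∀ᵐ t ∂unitMeasure, 0 < w t) (f : LpUnit p) (n : ℕ) :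
    ((weightedRot p β w hw hb ^ n) f : ℝ → ℂ) =ᵐ[unitMeasure] fun t =>
      ((Real.exp (birkhoffSum (rot β) (fun t => Real.log (w t)) n t) : ℝ) : ℂ) *
        f ((rot β)^[n] t) := by
  induction n with
  | zero => simp
  | succ n ih =>
    rw [pow_succ', mul_apply_eq_comp]
    filter_upwards [weightedRot_coeFn β hw hb ((weightedRot p β w hw hb ^ n) f),
      (measurePreserving_rot β).quasiMeasurePreserving.ae ih, hpos] with t h1 h2 h3
    rw [h1, h2, birkhoffSum_succ', Real.exp_add, Real.exp_log h3, Function.iterate_succ_apply]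
    push_cast
    ring

/-- The measure of the set where a measurable function exceeds `a n` tends to zero as
`a n → ∞`. -/
theorem tendsto_measure_le_norm {g : ℝ → ℂ} (hg : AEStronglyMeasurable g unitMeasure)
    {a : ℕ → ℝ} (ha : Tendsto a atTop atTop) :
    Tendsto (fun n => unitMeasure {t | a n ≤ ‖g t‖}) atTop (𝓝 0) := by
  have h1 : TendstoInMeasure unitMeasure (fun n t => (a n)⁻¹ • g t) atTop fun _ => 0 := by
    refine tendstoInMeasure_of_tendsto_ae (fun n => hg.const_smul ((a n)⁻¹)) (ae_of_all _ fun t => ?_)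
    simpa using (tendsto_inv_atTop_zero.comp ha).smul_const (g t)
  rw [tendstoInMeasure_iff_norm] at h1
  refine tendsto_of_tendsto_of_tendsto_of_le_of_le' tendsto_const_nhds (h1 1 one_pos)
    (Eventually.of_forall fun _ => zero_le) ?_
  filter_upwards [ha.eventually_gt_atTop 0] with n hn
  refine measure_mono fun t ht => ?_
  simp only [mem_ofPred_eq, sub_zero, norm_smul, norm_inv, Real.norm_eq_abs, abs_of_pos hn] at ht ⊢
  rw [inv_mul_eq_div, one_le_div hn]
  exact ht

theorem tendsto_exp_mul_atTop {η : ℝ} (hη : 0 < η) {c : ℝ} (hc : 0 < c) :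
    Tendsto (fun n : ℕ => c * Real.exp (n * η)) atTop atTop :=
  (Real.tendsto_exp_atTop.comp
    (tendsto_natCast_atTop_atTop.atTop_mul_const hη)).const_mul_atTop hc

theorem birkhoffSum_eq_mul_average (f : ℝ → ℝ) (g : ℝ → ℝ) (n : ℕ) (t : ℝ) :
    birkhoffSum f g n t = n * birkhoffAverage ℝ f g n t := by
  rcases eq_or_ne n 0 with rfl | hn
  · simp
  · rw [birkhoffAverage, smul_eq_mul, mul_inv_cancel_left₀ (by exact_mod_cast hn)]

/-- Above the critical radius the normalized orbits converge to zero in measure. -/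
theorem tendstoInMeasure_inv_pow_smul (hpos : ∀ᵐ t ∂unitMeasure, 0 < w t)
    (hlim : TendstoInMeasure unitMeasure
      (fun n => birkhoffAverage ℝ (rot β) (fun t => Real.log (w t)) n) atTop fun _ => -1)
    {z : ℝ} (hz : Real.exp (-1) < z) (b : LpUnit p) :
    TendstoInMeasure unitMeasure
      (fun n t => ((z⁻¹ ^ n : ℝ) : ℂ) * (weightedRot p β w hw hb ^ n) b t) atTop fun _ => 0 := by
  have hz0 : 0 < z := (Real.exp_pos _).trans hz
  -- The gap between `log z` and `-1` is split in two: one `η` absorbs the error of the Birkhoff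
  -- average, the other the size of `b` along the orbit.
  obtain ⟨η, hη, hzη⟩ : ∃ η : ℝ, 0 < η ∧ z = Real.exp (-1 + 2 * η) := by
    refine ⟨(Real.log z + 1) / 2, ?_, ?_⟩
    · have := (Real.lt_log_iff_exp_lt hz0).2 hz
      linarith
    · rw [show -1 + 2 * ((Real.log z + 1) / 2) = Real.log z by ring, Real.exp_log hz0]
  rw [tendstoInMeasure_iff_norm] at hlim ⊢
  intro ε hε
  have h1 := (hlim η hη).add (tendsto_measure_le_norm (Lp.aestronglyMeasurable b)
    (tendsto_exp_mul_atTop hη hε))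
  rw [add_zero] at h1
  refine tendsto_of_tendsto_of_tendsto_of_le_of_le tendsto_const_nhds h1
    (fun _ => zero_le) fun n => ?_
  -- Invariance of the measure replaces `b` at the moving point by the fixed function `b`.
  have hmeas : unitMeasure {t | ε * Real.exp (n * η) ≤ ‖b t‖} =
      unitMeasure ((rot β)^[n] ⁻¹' {t | ε * Real.exp (n * η) ≤ ‖b t‖}) := by
    rw [((measurePreserving_rot β).iterate n).measure_preimage]
    exact nullMeasurableSet_le aemeasurable_const (Lp.aestronglyMeasurable b).norm.aemeasurable
  change _ ≤ unitMeasure _ + unitMeasure _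
  rw [hmeas]
  refine le_trans (measure_mono_ae ?_) (measure_union_le _ _)
  filter_upwards [weightedRot_pow_coeFn (hw := hw) (hb := hb) (β := β) hpos b n] with t ht hle
  change ε ≤ ‖_ - 0‖ at hle
  change η ≤ ‖_‖ ∨ ε * Real.exp (n * η) ≤ ‖b ((rot β)^[n] t)‖
  rw [or_iff_not_imp_left, not_le]
  intro hA
  rw [Real.norm_eq_abs, abs_lt] at hA
  rw [sub_zero, ht, birkhoffSum_eq_mul_average, norm_mul, norm_mul, Complex.norm_real,
    Complex.norm_real, Real.norm_eq_abs, Real.norm_eq_abs, abs_of_pos (by positivity),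
    abs_of_pos (by positivity), hzη, ← Real.exp_neg, ← Real.exp_nat_mul, ← mul_assoc,
    ← Real.exp_add] at hle
  have hexp : Real.exp (n * -(-1 + 2 * η) +
      n * birkhoffAverage ℝ (rot β) (fun t => Real.log (w t)) n t) ≤ Real.exp (-(n * η)) := by
    refine Real.exp_le_exp.2 ?_
    have hn : (0 : ℝ) ≤ n := n.cast_nonneg
    nlinarith [hA.2]
  have h2 := hle.trans (mul_le_mul_of_nonneg_right hexp (norm_nonneg _))
  rwa [Real.exp_neg, inv_mul_eq_div, le_div_iff₀ (Real.exp_pos _)] at h2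

theorem ReNonneg.weightedRot (hpos : ∀ᵐ t ∂unitMeasure, 0 < w t) {f : LpUnit p}
    (hf : ReNonneg f) : ReNonneg (weightedRot p β w hw hb f) := by
  filter_upwards [weightedRot_coeFn β hw hb f, hpos,
    (measurePreserving_rot β).quasiMeasurePreserving.ae hf] with t h1 h2 h3
  rw [h1, Complex.re_ofReal_mul]
  exact mul_nonneg h2.le h3

/-- Norm convergence gives almost everywhere convergence along a subsequence, which suffices for a
closed condition. -/
theorem ReNonneg.of_tendsto {f : ℕ → LpUnit p} {g : LpUnit p} (hf : ∀ n, ReNonneg (f n))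
    (h : Tendsto f atTop (𝓝 g)) : ReNonneg g := by
  obtain ⟨ns, -, hns⟩ := (tendstoInMeasure_of_tendsto_Lp h).exists_seq_tendsto_ae
  filter_upwards [hns, ae_all_iff.2 hf] with t h1 h2
  exact ge_of_tendsto' ((Complex.continuous_re.tendsto _).comp h1) fun n => h2 _

theorem ReNonneg.hasSum {f : ℕ → LpUnit p} {g : LpUnit p} (hf : ∀ n, ReNonneg (f n))
    (h : HasSum f g) : ReNonneg g := by
  refine ReNonneg.of_tendsto (fun n => ?_) h.tendsto_sum_nat
  induction n with
  | zero => simpa using reNonneg_zero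
  | succ n ih =>
    rw [Finset.sum_range_succ]
    exact ih.add (hf n)

/-- The difference telescopes to the sum of `z^k T^(n-1-k) y` over `k < n`, and `T` preserves the
cone. -/
theorem ReNonneg.pow_smul_sub (hpos : ∀ᵐ t ∂unitMeasure, 0 < w t) {z : ℝ} (hz : 0 ≤ z)
    {b y : LpUnit p} (hy : ReNonneg y) (hby : (z : ℂ) • b - Bishop.weightedRot p β w hw hb b = y)
    (n : ℕ) : ReNonneg (((z ^ n : ℝ) : ℂ) • b - (Bishop.weightedRot p β w hw hb ^ n) b) := by
  induction n with
  | zero => simpa using reNonneg_zero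
  | succ n ih =>
    have h : ((z ^ (n + 1) : ℝ) : ℂ) • b - (Bishop.weightedRot p β w hw hb ^ (n + 1)) b =
        ((z ^ n : ℝ) : ℂ) • y + Bishop.weightedRot p β w hw hb
          (((z ^ n : ℝ) : ℂ) • b - (Bishop.weightedRot p β w hw hb ^ n) b) := by
      rw [map_sub, map_smul, ← hby, smul_sub, smul_smul, pow_succ' (Bishop.weightedRot p β w hw hb),
        mul_apply_eq_comp]
      push_cast
      rw [pow_succ]
      abel
    rw [h]
    exact (hy.smul (by positivity)).add (ih.weightedRot hpos)

/-- Above the critical radius the resolvent equation has only solutions with nonnegative real part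
for right-hand sides with nonnegative real part. -/
theorem ReNonneg.of_resolvent (hpos : ∀ᵐ t ∂unitMeasure, 0 < w t)
    (hlim : TendstoInMeasure unitMeasure
      (fun n => birkhoffAverage ℝ (rot β) (fun t => Real.log (w t)) n) atTop fun _ => -1)
    {z : ℝ} (hz : Real.exp (-1) < z) {b y : LpUnit p} (hy : ReNonneg y)
    (hby : (z : ℂ) • b - Bishop.weightedRot p β w hw hb b = y) : ReNonneg b := by
  have hz0 : 0 < z := (Real.exp_pos _).trans hz
  obtain ⟨ns, -, hns⟩ := (tendstoInMeasure_inv_pow_smul (hw := hw) (hb := hb) hpos hlim hz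
    b).exists_seq_tendsto_ae
  have hall : ∀ᵐ t ∂unitMeasure, ∀ n : ℕ,
      (((z⁻¹ ^ n : ℝ) : ℂ) * (Bishop.weightedRot p β w hw hb ^ n) b t).re ≤ (b t).re := by
    refine ae_all_iff.2 fun n => ?_
    filter_upwards [ReNonneg.pow_smul_sub hpos hz0.le hy hby n,
      Lp.coeFn_sub (((z ^ n : ℝ) : ℂ) • b) ((Bishop.weightedRot p β w hw hb ^ n) b),
      Lp.coeFn_smul ((z ^ n : ℝ) : ℂ) b] with t h1 h2 h3
    rw [h2, Pi.sub_apply, h3, Pi.smul_apply, smul_eq_mul, Complex.sub_re,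
      Complex.re_ofReal_mul] at h1
    rw [Complex.re_ofReal_mul, inv_pow, inv_mul_le_iff₀ (by positivity)]
    linarith
  filter_upwards [hns, hall] with t h1 h2
  exact le_of_tendsto' ((Complex.continuous_re.tendsto 0).comp h1) fun n => h2 (ns n)

/-- Below the critical radius the resolvent equation with the indicator of a non-null set as
right-hand side has no solution with nonnegative real part. -/
theorem not_reNonneg_of_resolvent_indicator (hpos : ∀ᵐ t ∂unitMeasure, 0 < w t)
    (hlim : TendstoInMeasure unitMeasure
      (fun n => birkhoffAverage ℝ (rot β) (fun t => Real.log (w t)) n) atTop fun _ => -1)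
    {z : ℝ} (hz0 : 0 < z) (hz : z < Real.exp (-1)) {b x : LpUnit p} {s : Set ℝ}
    (hs : MeasurableSet s) (hs0 : unitMeasure s ≠ 0)
    (hx : x =ᵐ[unitMeasure] s.indicator fun _ => 1)
    (hbx : (z : ℂ) • b - Bishop.weightedRot p β w hw hb b = x) : ¬ ReNonneg b := by
  intro hb0
  obtain ⟨η, hη, hzη⟩ : ∃ η : ℝ, 0 < η ∧ z = Real.exp (-1 - 2 * η) := by
    refine ⟨-(Real.log z + 1) / 2, ?_, ?_⟩
    · have := (Real.log_lt_iff_lt_exp hz0).2 hz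
      linarith
    · rw [show -1 - 2 * (-(Real.log z + 1) / 2) = Real.log z by ring, Real.exp_log hz0]
  have hx0 : ReNonneg x := by
    filter_upwards [hx] with t ht
    rw [ht]
    by_cases h : t ∈ s <;> simp [h]
  -- From `T^n x = z T^n b - T^(n+1) b`, the difference `z^(n+1) b - T^n x` equals `z (z^n b - T^n
  -- b) + T^(n+1) b`; the last term lies in the cone because `b` is assumed to.
  have hbound : ∀ n : ℕ, ∀ᵐ t ∂unitMeasure,
      ((Bishop.weightedRot p β w hw hb ^ n) x t).re ≤ z ^ (n + 1) * (b t).re := fun n => by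
    have hT : ReNonneg ((Bishop.weightedRot p β w hw hb ^ (n + 1)) b) := by
      generalize n + 1 = m
      induction m with
      | zero => simpa using hb0
      | succ m ih =>
        rw [pow_succ', mul_apply_eq_comp]
        exact ih.weightedRot hpos
    have h : ((z ^ (n + 1) : ℝ) : ℂ) • b - (Bishop.weightedRot p β w hw hb ^ n) x =
        (z : ℂ) • (((z ^ n : ℝ) : ℂ) • b - (Bishop.weightedRot p β w hw hb ^ n) b) +
          (Bishop.weightedRot p β w hw hb ^ (n + 1)) b := by
      rw [← hbx, map_sub, map_smul, smul_sub, smul_smul, pow_succ (Bishop.weightedRot p β w hw hb),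
        mul_apply_eq_comp]
      push_cast
      rw [pow_succ']
      abel
    have hR : ReNonneg (((z ^ (n + 1) : ℝ) : ℂ) • b - (Bishop.weightedRot p β w hw hb ^ n) x) := by
      rw [h]
      exact ((ReNonneg.pow_smul_sub hpos hz0.le hx0 hbx n).smul hz0.le).add hT
    filter_upwards [hR, Lp.coeFn_sub (((z ^ (n + 1) : ℝ) : ℂ) • b)
      ((Bishop.weightedRot p β w hw hb ^ n) x),
      Lp.coeFn_smul ((z ^ (n + 1) : ℝ) : ℂ) b] with t h1 h2 h3
    rw [h2, Pi.sub_apply, h3, Pi.smul_apply, smul_eq_mul, Complex.sub_re,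
      Complex.re_ofReal_mul] at h1
    linarith
  rw [tendstoInMeasure_iff_norm] at hlim
  have h1 := (hlim η hη).add (tendsto_measure_le_norm (Lp.aestronglyMeasurable b)
    (tendsto_exp_mul_atTop hη (inv_pos.2 hz0)))
  rw [add_zero] at h1
  -- The preimage of `s` under the `n`-th iterate has the measure of `s` for every `n`. It is
  -- covered by the set where the Birkhoff average is off by `η` and the set where `‖b‖` is at least
  -- `z⁻¹ exp(nη)`, whose measures tend to zero.
  refine hs0 (le_antisymm (ge_of_tendsto' h1 fun n => ?_) zero_le)
  rw [← ((measurePreserving_rot β).iterate n).measure_preimage hs.nullMeasurableSet]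
  change _ ≤ unitMeasure _ + unitMeasure _
  refine le_trans (measure_mono_ae ?_) (measure_union_le _ _)
  filter_upwards [weightedRot_pow_coeFn (hw := hw) (hb := hb) (β := β) hpos x n, hbound n,
    ((measurePreserving_rot β).iterate n).quasiMeasurePreserving.ae hx] with t h1 h2 h3 hts
  change η ≤ ‖_‖ ∨ z⁻¹ * Real.exp (n * η) ≤ ‖b t‖
  rw [or_iff_not_imp_left, not_le]
  intro hA
  rw [Real.norm_eq_abs, abs_lt] at hA
  have hts' : (rot β)^[n] t ∈ s := hts
  rw [h1, h3, indicator_of_mem hts', mul_one, Complex.ofReal_re, birkhoffSum_eq_mul_average] at h2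
  rw [inv_mul_le_iff₀ hz0]
  have hle : Real.exp (n * η) * z ^ n ≤ z ^ n * (z * ‖b t‖) := by
    calc Real.exp (n * η) * z ^ n = Real.exp (n * (-1 - η)) := by
          rw [hzη, ← Real.exp_nat_mul, ← Real.exp_add]
          congr 1
          ring
      _ ≤ Real.exp (n * birkhoffAverage ℝ (rot β) (fun t => Real.log (w t)) n t) := by
          refine Real.exp_le_exp.2 (mul_le_mul_of_nonneg_left ?_ n.cast_nonneg)
          linarith [hA.1]
      _ ≤ z ^ (n + 1) * (b t).re := h2
      _ ≤ z ^ (n + 1) * ‖b t‖ :=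
          mul_le_mul_of_nonneg_left (Complex.re_le_norm _) (by positivity)
      _ = z ^ n * (z * ‖b t‖) := by ring
  rw [mul_comm] at hle
  exact le_of_mul_le_mul_left hle (by positivity)

end Bishop

/-! ### Taylor expansion of a local resolvent function across the critical radius -/

namespace Bishop

section Resolvent

variable {X : Type*} [NormedAddCommGroup X] [NormedSpace ℂ X] [CompleteSpace X]

/-- The derivatives of a local resolvent function solve the iterated resolvent equation. -/
theorem resolvent_iteratedDeriv {T : X →L[ℂ] X} {x : X} {U : Set ℂ} (hU : IsOpen U) {f : ℂ → X}
    (hf : DifferentiableOn ℂ f U) (hfx : ∀ z ∈ U, T (f z) - z • f z = x) (m : ℕ) :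
    ∀ z ∈ U, T (iteratedDeriv (m + 1) f z) - z • iteratedDeriv (m + 1) f z =
      ((m + 1 : ℕ) : ℂ) • iteratedDeriv m f z := by
  have hd : ∀ k : ℕ, ∀ z ∈ U, HasDerivAt (iteratedDeriv k f) (iteratedDeriv (k + 1) f z) z := by
    intro k z hz
    rw [iteratedDeriv_succ]
    have han : AnalyticAt ℂ f z := hf.analyticAt (hU.mem_nhds hz)
    rw [iteratedDeriv_eq_iterate]
    exact (han.iterated_deriv k).differentiableAt.hasDerivAt
  -- The product rule contributes an extra `-f^(k)` at each differentiation; these accumulate to the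
  -- factor `m + 1`.
  have key : ∀ k : ℕ, ∀ z ∈ U,
      HasDerivAt (fun v => T (iteratedDeriv k f v) - v • iteratedDeriv k f v)
        (T (iteratedDeriv (k + 1) f z) - (z • iteratedDeriv (k + 1) f z + iteratedDeriv k f z))
        z := by
    intro k z hz
    have h1 := (T.hasFDerivAt (x := iteratedDeriv k f z)).comp_hasDerivAt z (hd k z hz)
    have h2 := (hasDerivAt_id z).smul (hd k z hz)
    rw [one_smul] at h2
    exact h1.sub h2
  induction m with
  | zero =>
    intro z hz
    have h1 := key 0 z hz
    have h2 : HasDerivAt (fun v => T (iteratedDeriv 0 f v) - v • iteratedDeriv 0 f v) 0 z := by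
      refine (hasDerivAt_const z x).congr_of_eventuallyEq ?_
      filter_upwards [hU.mem_nhds hz] with v hv
      simpa using hfx v hv
    have h3 := h1.unique h2
    rw [← sub_sub, sub_eq_zero] at h3
    rw [h3]
    simp
  | succ m ih =>
    intro z hz
    have h1 := key (m + 1) z hz
    have h2 : HasDerivAt (fun v => T (iteratedDeriv (m + 1) f v) - v • iteratedDeriv (m + 1) f v)
        (((m + 1 : ℕ) : ℂ) • iteratedDeriv (m + 1) f z) z := by
      refine ((hd m z hz).const_smul ((m + 1 : ℕ) : ℂ)).congr_of_eventuallyEq ?_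
      filter_upwards [hU.mem_nhds hz] with v hv
      exact ih v hv
    have h3 := h1.unique h2
    rw [← sub_sub, sub_eq_iff_eq_add] at h3
    rw [h3]
    push_cast
    module

end Resolvent

variable {p : ℝ≥0∞} [Fact (1 ≤ p)] {w : ℝ → ℝ} {β : ℝ} {hw : Measurable w}
  {hb : ∀ t ∈ Ico (0 : ℝ) 1, |w t| ≤ 1}

/-- A weighted rotation whose logarithmic weight has Birkhoff averages converging to `-1` has
`e⁻¹` in its local spectrum at every indicator function of a non-null set. -/
theorem exp_neg_one_mem_localSpectrum (hpos : ∀ᵐ t ∂unitMeasure, 0 < w t)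
    (hlim : TendstoInMeasure unitMeasure
      (fun n => birkhoffAverage ℝ (rot β) (fun t => Real.log (w t)) n) atTop fun _ => -1)
    {x : LpUnit p} {s : Set ℝ} (hs : MeasurableSet s) (hs0 : unitMeasure s ≠ 0)
    (hx : x =ᵐ[unitMeasure] s.indicator fun _ => 1) :
    ((Real.exp (-1) : ℝ) : ℂ) ∈ localSpectrum (weightedRot p β w hw hb) x := by
  rintro ⟨U, hU, heU, f, hf, hfx⟩
  set T := weightedRot p β w hw hb with hT
  set e : ℝ := Real.exp (-1) with he
  have he0 : 0 < e := Real.exp_pos _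
  obtain ⟨δ, hδ, hball⟩ := Metric.isOpen_iff.1 hU _ heU
  -- The disc of radius `δ/2` about `z₀` stays in the `δ`-ball about `e`, and it contains `z₁ = e -
  -- η` because `δ/4 + η ≤ 3δ/8`. The bound `η ≤ e/2` keeps `z₁` positive.
  set z₀ : ℝ := e + δ / 4 with hz₀
  set η : ℝ := min (δ / 8) (e / 2) with hη
  have hη0 : 0 < η := lt_min (by linarith) (by linarith)
  have hη1 : η ≤ δ / 8 := min_le_left _ _
  have hη2 : η ≤ e / 2 := min_le_right _ _
  set z₁ : ℝ := e - η with hz₁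
  have hsub : Metric.ball (z₀ : ℂ) (δ / 2) ⊆ U := by
    refine (Metric.ball_subset_ball' ?_).trans hball
    rw [Complex.dist_eq, ← Complex.ofReal_sub, Complex.norm_real, Real.norm_eq_abs, hz₀,
      add_sub_cancel_left, abs_of_pos (by linarith)]
    linarith
  have hz₁b : (z₁ : ℂ) ∈ Metric.ball (z₀ : ℂ) (δ / 2) := by
    rw [Metric.mem_ball, Complex.dist_eq, ← Complex.ofReal_sub, Complex.norm_real,
      Real.norm_eq_abs, abs_lt]
    constructor <;> linarith
  have hz₀U : (z₀ : ℂ) ∈ U := hsub (Metric.mem_ball_self (by linarith))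
  have hx0 : ReNonneg x := by
    filter_upwards [hx] with t ht
    rw [ht]
    by_cases h : t ∈ s <;> simp [h]
  -- Each derivative solves the resolvent equation with a positive multiple of the previous one as
  -- right-hand side, up to sign; `(-1)^(m+1)` records the change from `T - z` to `z - T` at every
  -- stage.
  have hcoef : ∀ m : ℕ, ReNonneg (((-1) ^ (m + 1) : ℂ) • iteratedDeriv m f z₀) := by
    intro m
    induction m with
    | zero =>
      refine ReNonneg.of_resolvent (hw := hw) (hb := hb) hpos hlim (z := z₀) (by linarith) hx0 ?_
      rw [← hfx z₀ hz₀U, iteratedDeriv_zero, map_smul]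
      module
    | succ m ih =>
      refine ReNonneg.of_resolvent (hw := hw) (hb := hb) hpos hlim (z := z₀) (by linarith)
        (ih.smul (c := ((m + 1 : ℕ) : ℝ)) (by positivity)) ?_
      have h := resolvent_iteratedDeriv hU hf.differentiableOn hfx m z₀ hz₀U
      rw [Complex.ofReal_natCast, smul_comm ((m + 1 : ℕ) : ℂ), ← h, map_smul, pow_succ _ (m + 1)]
      module
  have hsum := Complex.hasSum_taylorSeries_on_ball (hf.differentiableOn.mono hsub) hz₁b
  have hnonneg : ReNonneg (-f z₁) := by
    refine ReNonneg.hasSum (fun m => ?_) hsum.neg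
    -- As `z₁ < z₀`, the sign of `(z₁ - z₀)^m` cancels the alternation of the derivatives.
    have h := (hcoef m).smul (c := ((m.factorial : ℝ))⁻¹ * (z₀ - z₁) ^ m)
      (mul_nonneg (by positivity) (pow_nonneg (by linarith) _))
    convert h using 1
    rw [smul_smul, smul_smul, ← neg_smul]
    congr 1
    push_cast
    rw [show (z₁ : ℂ) - z₀ = (-1) * (z₀ - z₁) by ring, mul_pow, pow_succ]
    ring
  refine not_reNonneg_of_resolvent_indicator (hw := hw) (hb := hb) hpos hlim (z := z₁)
    (by linarith) (by linarith) hs hs0 hx ?_ hnonneg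
  rw [← hfx z₁ (hsub hz₁b), map_neg]
  module

end Bishop

/-! ### Complex conjugation and symmetry of the local spectrum -/

namespace Bishop

variable {p : ℝ≥0∞}

/-- Complex conjugation on `L^p[0,1)`, as a conjugate-linear continuous map. -/
noncomputable def conjLp (p : ℝ≥0∞) [Fact (1 ≤ p)] : LpUnit p →SL[starRingEnd ℂ] LpUnit p :=
  LinearMap.mkContinuous
    { toFun := fun f => star f
      map_add' := fun f g => by
        refine Lp.ext ?_
        filter_upwards [Lp.coeFn_star (f + g), Lp.coeFn_star f, Lp.coeFn_star g,
          Lp.coeFn_add f g, Lp.coeFn_add (star f) (star g)] with t h1 h2 h3 h4 h5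
        refine h1.trans ((congrArg star h4).trans (Eq.trans ?_ h5.symm))
        change star (f t + g t) = (star f : LpUnit p) t + (star g : LpUnit p) t
        rw [h2, h3, star_add, Pi.star_apply, Pi.star_apply]
      map_smul' := fun c f => by
        refine Lp.ext ?_
        filter_upwards [Lp.coeFn_star (c • f), Lp.coeFn_star f, Lp.coeFn_smul c f,
          Lp.coeFn_smul (starRingEnd ℂ c) (star f)] with t h1 h2 h3 h4
        refine h1.trans ((congrArg star h3).trans (Eq.trans ?_ h4.symm))
        change star (c • f t) = starRingEnd ℂ c • (star f : LpUnit p) t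
        rw [h2, star_smul, Pi.star_apply]
        rfl }
    1 fun f => by
      rw [one_mul]
      refine Lp.norm_le_norm_of_ae_le ?_
      filter_upwards [Lp.coeFn_star f] with t ht
      simp [ht]

theorem conjLp_coeFn [Fact (1 ≤ p)] (f : LpUnit p) :
    conjLp p f =ᵐ[unitMeasure] fun t => starRingEnd ℂ (f t) :=
  Lp.coeFn_star f

theorem conjLp_indB [Fact (1 ≤ p)] (α : ℝ) : conjLp p (indB p α) = indB p α := by
  refine Lp.ext ?_
  have h : (indB p α : ℝ → ℂ) =ᵐ[unitMeasure] (setB α).indicator fun _ => 1 :=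
    indicatorConstLp_coeFn
  filter_upwards [conjLp_coeFn (indB p α), h] with t h1 h2
  rw [h1, h2]
  by_cases ht : t ∈ setB α <;> simp [ht]

theorem conjLp_weightedRot [Fact (1 ≤ p)] {w : ℝ → ℝ} (β : ℝ) (hw : Measurable w)
    (hb : ∀ t ∈ Ico (0 : ℝ) 1, |w t| ≤ 1) (f : LpUnit p) :
    conjLp p (weightedRot p β w hw hb f) = weightedRot p β w hw hb (conjLp p f) := by
  refine Lp.ext ?_
  filter_upwards [conjLp_coeFn (weightedRot p β w hw hb f), weightedRot_coeFn β hw hb f,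
    weightedRot_coeFn β hw hb (conjLp p f),
    (measurePreserving_rot β).quasiMeasurePreserving.ae (conjLp_coeFn f)] with t h1 h2 h3 h4
  rw [h1, h2, h3, h4, map_mul, Complex.conj_ofReal]

end Bishop

/-- If `T` commutes with a conjugation `C` fixing `x`, the local resolvent set of `T` at `x` is
symmetric with respect to the real axis. -/
theorem Bishop.conj_mem_localResolventSet {X : Type*} [NormedAddCommGroup X] [NormedSpace ℂ X]
    [CompleteSpace X] {T : X →L[ℂ] X} {C : X →SL[starRingEnd ℂ] X} {x : X}
    (hC : ∀ y, C (T y) = T (C y)) (hx : C x = x) {z : ℂ}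
    (hz : z ∈ localResolventSet T x) : starRingEnd ℂ z ∈ localResolventSet T x := by
  obtain ⟨U, hU, hzU, f, hf, hfx⟩ := hz
  have hUo : IsOpen (starRingEnd ℂ ⁻¹' U) := hU.preimage Complex.continuous_conj
  refine ⟨starRingEnd ℂ ⁻¹' U, hUo, by simpa using hzU, fun v => C (f (starRingEnd ℂ v)), ?_, ?_⟩
  · refine DifferentiableOn.analyticOnNhd (fun v hv => ?_) hUo
    have h1 : DifferentiableAt ℂ f (starRingEnd ℂ v) := (hf _ hv).differentiableAt
    -- Conjugating both the variable and the value restores complex differentiability.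
    exact (h1.comp_semilinear₂ C (starL ℂ : ℂ ≃L⋆[ℂ] ℂ).toContinuousLinearMap
      (z := v)).differentiableWithinAt
  · intro v hv
    have h := congrArg C (hfx _ hv)
    rw [map_sub, hC, C.map_smulₛₗ, hx, Complex.conj_conj] at h
    exact h

/-! ### Positive measure of `setB α` -/

namespace Bishop

theorem distInt_rot (β t : ℝ) : distInt (rot β t) = distInt (t + β) := by
  rw [distInt, rot, Int.fract_fract, distInt]

/-- A rotation reduces this to `x = 0`, where two end intervals of length `ε` cover the set. -/
theorem measure_distInt_le (ε x : ℝ) :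
    unitMeasure {t | distInt (t - x) ≤ ε} ≤ ENNReal.ofReal (2 * ε) := by
  have h : {t | distInt (t - x) ≤ ε} = rot (-x) ⁻¹' {t | distInt t ≤ ε} := by
    ext t
    simp only [mem_ofPred_eq, mem_preimage, distInt_rot, sub_eq_add_neg]
  rw [h, (measurePreserving_rot (-x)).measure_preimage
    (measurableSet_le measurable_distInt measurable_const).nullMeasurableSet]
  rw [Measure.restrict_apply (measurableSet_le measurable_distInt measurable_const)]
  have hsub : {t | distInt t ≤ ε} ∩ Ico 0 1 ⊆ Icc 0 ε ∪ Icc (1 - ε) 1 := by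
    rintro t ⟨h1, h2⟩
    rw [mem_ofPred_eq, distInt, Int.fract_eq_self.2 h2, min_le_iff] at h1
    rcases h1 with h1 | h1
    · exact Or.inl ⟨h2.1, h1⟩
    · exact Or.inr ⟨by linarith, h2.2.le⟩
  refine (measure_mono hsub).trans ((measure_union_le _ _).trans ?_)
  rw [Real.volume_Icc, Real.volume_Icc]
  rcases le_or_gt 0 ε with h0 | h0
  · rw [← ENNReal.ofReal_add (by linarith) (by linarith)]
    exact ENNReal.ofReal_le_ofReal (by linarith)
  · rw [ENNReal.ofReal_of_nonpos (by linarith), ENNReal.ofReal_of_nonpos (by linarith)]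
    simp

theorem hasSum_int_inv_sq : HasSum (fun n : ℤ => 1 / (10 * (n : ℝ) ^ 2)) (Real.pi ^ 2 / 30) := by
  have h0 : HasSum (fun n : ℕ => 1 / (10 * (n : ℝ) ^ 2)) (Real.pi ^ 2 / 60) := by
    have h := hasSum_zeta_two.mul_left (1 / 10)
    rw [show 1 / 10 * (Real.pi ^ 2 / 6) = Real.pi ^ 2 / 60 by ring] at h
    refine h.congr_fun fun n => ?_
    ring
  have h1 : HasSum (fun n : ℕ => 1 / (10 * ((n : ℝ) + 1) ^ 2)) (Real.pi ^ 2 / 60) := by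
    have := (hasSum_nat_add_iff' (f := fun n : ℕ => 1 / (10 * (n : ℝ) ^ 2)) 1).2 h0
    simpa using this
  have h2 := HasSum.of_nat_of_neg_add_one (f := fun n : ℤ => 1 / (10 * (n : ℝ) ^ 2))
    (m := Real.pi ^ 2 / 60) (m' := Real.pi ^ 2 / 60)
    (by simpa using h0) (by
      convert h1 using 3 with n
      push_cast
      ring)
  convert h2 using 1
  ring

/-- The two end intervals remove at most `1/10`, and the neighbourhoods of the points `nα` at most
the sum of `1/(10 n²)` over `n ≠ 0`, which is `π²/30`; the total is less than `1`. -/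
theorem measure_setB_pos (α : ℝ) : 0 < unitMeasure (setB α) := by
  by_contra hneg
  have hz : unitMeasure (setB α) = 0 := by simpa using hneg
  have hcov : Ico (0 : ℝ) 1 ⊆ setB α ∪ (Icc 0 (1 / 20) ∪ Icc (19 / 20) 1 ∪
      ⋃ n : ℤ, {t | distInt (t - n * α) ≤ 1 / (20 * (n : ℝ) ^ 2)} ∩ {_t | n ≠ 0}) := by
    intro t ht
    by_cases hB : t ∈ setB α
    · exact Or.inl hB
    right
    by_cases h1 : t ≤ 1 / 20
    · exact Or.inl (Or.inl ⟨ht.1, h1⟩)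
    by_cases h2 : 19 / 20 ≤ t
    · exact Or.inl (Or.inr ⟨h2, ht.2.le⟩)
    right
    by_contra hn
    simp only [mem_iUnion, mem_inter_iff, mem_ofPred_eq, not_exists, not_and'] at hn
    exact hB ⟨not_le.1 h1, not_le.1 h2, fun n hn0 => not_le.1 (hn n hn0)⟩
  have hle : unitMeasure (Ico (0 : ℝ) 1) ≤ ENNReal.ofReal (1 / 10 + Real.pi ^ 2 / 30) := by
    refine (measure_mono hcov).trans ((measure_union_le _ _).trans ?_)
    rw [hz, zero_add]
    refine (measure_union_le _ _).trans ?_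
    rw [ENNReal.ofReal_add (by norm_num) (by positivity)]
    refine add_le_add ?_ ?_
    · refine (measure_union_le _ _).trans ?_
      refine (add_le_add (Measure.restrict_apply_le _ _) (Measure.restrict_apply_le _ _)).trans ?_
      rw [Real.volume_Icc, Real.volume_Icc, ← ENNReal.ofReal_add (by norm_num) (by norm_num)]
      exact ENNReal.ofReal_le_ofReal (by norm_num)
    · refine (measure_iUnion_le _).trans ?_
      rw [← hasSum_int_inv_sq.tsum_eq, ENNReal.ofReal_tsum_of_nonneg (fun n => by positivity)
        hasSum_int_inv_sq.summable]
      refine ENNReal.tsum_le_tsum fun n => ?_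
      refine (measure_mono inter_subset_left).trans ((measure_distInt_le _ _).trans ?_)
      refine ENNReal.ofReal_le_ofReal (le_of_eq ?_)
      -- The term `n = 0` costs nothing, since division by zero gives `0` on both sides.
      by_cases hn : (n : ℝ) = 0
      · simp [hn]
      · field_simp
        norm_num
  have h1 : unitMeasure (Ico (0 : ℝ) 1) = 1 := by simp [unitMeasure]
  rw [h1, ← ENNReal.ofReal_one, ENNReal.ofReal_le_ofReal_iff (by positivity)] at hle
  nlinarith [Real.pi_lt_d2, Real.pi_pos]

end Bishop

/-! ### The logarithm of the weight and the conclusion -/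

namespace Bishop

/-- From `|log t| t^(1/4) < 4` on `(0,1]`, the square of `log` is dominated by the integrable
function `16 t^(-1/2)`. -/
theorem memLp_log : MemLp Real.log 2 unitMeasure := by
  rw [memLp_two_iff_integrable_sq Real.measurable_log.aestronglyMeasurable]
  have h1 : Integrable (fun t : ℝ => 16 * t ^ (-(1 / 2) : ℝ)) unitMeasure := by
    have h := (intervalIntegral.intervalIntegrable_rpow' (a := 0) (b := 1)
      (r := -(1 / 2)) (by norm_num)).const_mul 16
    rw [intervalIntegrable_iff_integrableOn_Ico_of_le zero_le_one] at h
    exact h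
  refine h1.mono' (Real.measurable_log.pow_const 2).aestronglyMeasurable ?_
  have h0 : ∀ᵐ t : ℝ ∂unitMeasure, t ≠ 0 :=
    ae_restrict_of_ae (Measure.ae_ne volume 0)
  filter_upwards [ae_mem_Ico, h0] with t ht ht0
  have hpos : 0 < t := lt_of_le_of_ne ht.1 (Ne.symm ht0)
  have h2 := Real.abs_log_mul_self_rpow_lt t (1 / 4) hpos ht.2.le (by norm_num)
  rw [Real.norm_eq_abs, abs_of_nonneg (sq_nonneg _)]
  have h3 : (Real.log t * t ^ (1 / 4 : ℝ)) ^ 2 ≤ 16 := by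
    rw [← sq_abs]
    have := abs_nonneg (Real.log t * t ^ (1 / 4 : ℝ))
    nlinarith
  have h4 : (t ^ (1 / 4 : ℝ)) ^ 2 = t ^ (1 / 2 : ℝ) := by
    rw [← Real.rpow_natCast, ← Real.rpow_mul hpos.le]
    norm_num
  rw [mul_pow, h4] at h3
  rwa [Real.rpow_neg hpos.le, ← div_eq_mul_inv, le_div_iff₀ (by positivity)]

theorem integral_log_unitMeasure : ∫ t, Real.log t ∂unitMeasure = -1 := by
  rw [unitMeasure, integral_Ico_eq_integral_Ioc, ← intervalIntegral.integral_of_le zero_le_one,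
    integral_log]
  simp

theorem ae_pos : ∀ᵐ t ∂unitMeasure, 0 < t := by
  filter_upwards [ae_mem_Ico, ae_restrict_of_ae (Measure.ae_ne volume 0)] with t ht ht0
  exact lt_of_le_of_ne ht.1 (Ne.symm ht0)

theorem exp_neg_one_mem_localSpectrum_bishop {α : ℝ} (hα : Irrational α) (p : ℝ≥0∞)
    [Fact (1 ≤ p)] :
    ((Real.exp (-1) : ℝ) : ℂ) ∈ localSpectrum (bishop p α) (indB p α) := by
  refine exp_neg_one_mem_localSpectrum ae_pos ?_ (measurableSet_setB α) (measure_setB_pos α).ne'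
    indicatorConstLp_coeFn
  rw [← integral_log_unitMeasure]
  exact tendstoInMeasure_birkhoffAverage (ergodic_rot hα) memLp_log

theorem exp_neg_one_mem_localSpectrum_bishopAdjoint {α : ℝ} (hα : Irrational α) (q : ℝ≥0∞)
    [Fact (1 ≤ q)] :
    ((Real.exp (-1) : ℝ) : ℂ) ∈ localSpectrum (bishopAdjoint q α) (indB q α) := by
  have hm := measurePreserving_rot (-α)
  refine exp_neg_one_mem_localSpectrum (hm.quasiMeasurePreserving.ae ae_pos) ?_
    (measurableSet_setB α) (measure_setB_pos α).ne' indicatorConstLp_coeFn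
  -- The adjoint's weight is the identity composed with a measure preserving rotation, so its
  -- logarithm has the same mean.
  have h : ∫ t, Real.log (rot (-α) t) ∂unitMeasure = -1 := by
    rw [← integral_log_unitMeasure]
    have h := integral_map (μ := unitMeasure) hm.measurable.aemeasurable
      (f := Real.log) Real.measurable_log.aestronglyMeasurable
    rw [hm.map_eq] at h
    exact h.symm
  rw [← h]
  exact tendstoInMeasure_birkhoffAverage (ergodic_rot hα.neg)
    (memLp_log.comp_measurePreserving hm)

theorem conj_mem_localSpectrum_weightedRot {p : ℝ≥0∞} [Fact (1 ≤ p)] {w : ℝ → ℝ} (β α : ℝ)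
    (hw : Measurable w) (hb : ∀ t ∈ Ico (0 : ℝ) 1, |w t| ≤ 1) {z : ℂ}
    (hz : z ∈ localSpectrum (weightedRot p β w hw hb) (indB p α)) :
    starRingEnd ℂ z ∈ localSpectrum (weightedRot p β w hw hb) (indB p α) := fun h => by
  have h' := conj_mem_localResolventSet (conjLp_weightedRot β hw hb) (conjLp_indB α) h
  rw [Complex.conj_conj] at h'
  exact hz h'

end Bishop

end

theorem corollary5p2 (α : ℝ) (hα : Irrational α) (hα0 : 0 < α) (hα1 : α < 1)
    (p q : ℝ≥0∞) [Fact (1 ≤ p)] [Fact (1 ≤ q)] (hp : p ≠ ∞) [p.HolderConjugate q] :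
    ((∀ z : ℂ, z ∈ Bishop.localSpectrum (Bishop.bishop p α) (Bishop.indB p α) →
        (starRingEnd ℂ) z ∈ Bishop.localSpectrum (Bishop.bishop p α) (Bishop.indB p α)) ∧
      ((Real.exp (-1) : ℝ) : ℂ) ∈
        Bishop.localSpectrum (Bishop.bishop p α) (Bishop.indB p α)) ∧
    ((∀ z : ℂ, z ∈ Bishop.localSpectrum (Bishop.bishopAdjoint q α) (Bishop.indB q α) →
        (starRingEnd ℂ) z ∈
          Bishop.localSpectrum (Bishop.bishopAdjoint q α) (Bishop.indB q α)) ∧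
      ((Real.exp (-1) : ℝ) : ℂ) ∈
        Bishop.localSpectrum (Bishop.bishopAdjoint q α) (Bishop.indB q α)) :=
  ⟨⟨fun _ hz => Bishop.conj_mem_localSpectrum_weightedRot _ _ _ _ hz,
    Bishop.exp_neg_one_mem_localSpectrum_bishop hα p⟩,
   ⟨fun _ hz => Bishop.conj_mem_localSpectrum_weightedRot _ _ _ _ hz,
    Bishop.exp_neg_one_mem_localSpectrum_bishopAdjoint hα q⟩⟩
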